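/- For positive integers $k,d$, a $k$-ary $d$-dimensional semialgebraic predicate $\Phi(x_1,\dots,x_k)$, with $x_1,\dots,x_k\in\mathbb{R}^d$, is a Boolean combination of finitely many conditions of the form $f\ge 0$, where each $f$ is a real polynomial in the $kd$ coordinates $x_{i,j}$. A sequence $(p_1,\dots,p_n)$ of points of $\mathbb{R}^d$ is $\Phi$-homogeneous if $\Phi(p_{i_1},\dots,p_{i_k})$ holds either for every choice of $1\le i_1<\dots<i_k\le n$ or for no such choice. Let $R_\Phi(n)$ be the smallest $N$ such that every sequence of $N$ points of $\mathbb{R}^d$ contains a $\Phi$-homogeneous subsequence of length $n$. Define $\mathrm{twr}_1(x)=x$ and $\mathrm{twr}_{i+1}(x)=2^{\mathrm{twr}_i(x)}$. Theorem. For every $d\ge 2$ there are a $d$-dimensional semialgebraic predicate $\Phi$ of arity $k=d+3$, a real constant $c>0$ and an integer $n_0$ such that $$R_\Phi(n)\ \ge\ \mathrm{twr}_{k-1}(c\,n)\qquad\text{for all } n\ge n_0 .$$ -/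

import Mathlib

/-- The tower function: `twr 1 x = x` and `twr (i + 1) x = 2 ^ twr i x` for `i ≥ 1`
(the value at height `0` is irrelevant and set to `x`). -/
noncomputable def twr : ℕ → ℝ → ℝ
  | 0, x => x
  | 1, x => x
  | i + 2, x => (2 : ℝ) ^ twr (i + 1) x

/-- A `k`-ary predicate `Φ` on `ℝ^d` is semialgebraic if there are polynomials `f₁, …, f_t` with
real coefficients in the `k * d` variables `x_{i,j}` and a truth function `φ` of `t` Boolean
arguments such that `Φ(x₁, …, x_k) = φ(A₁, …, A_t)`, where `A_l` is the truth value of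
`f_l(x) ≥ 0`. (Classically a proposition is the same as its truth value, so `φ` is an arbitrary
Boolean function of `t` variables, which is the same as a Boolean formula up to equivalence.) -/
def IsSemialgebraic {k d : ℕ} (Φ : (Fin k → Fin d → ℝ) → Prop) : Prop :=
  ∃ (t : ℕ) (φ : (Fin t → Prop) → Prop) (f : Fin t → MvPolynomial (Fin k × Fin d) ℝ),
    ∀ x : Fin k → Fin d → ℝ,
      Φ x ↔ φ (fun l => 0 ≤ MvPolynomial.eval (fun ij : Fin k × Fin d => x ij.1 ij.2) (f l))

/-- A sequence `p` of `n` points is `Φ`-homogeneous if `Φ` holds for all `k`-tuples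
`p_{i₁}, …, p_{i_k}` with `i₁ < ⋯ < i_k`, or for none of them. -/
def IsHomogeneous {k d n : ℕ} (Φ : (Fin k → Fin d → ℝ) → Prop) (p : Fin n → Fin d → ℝ) : Prop :=
  (∀ i : Fin k → Fin n, StrictMono i → Φ (p ∘ i)) ∨
    (∀ i : Fin k → Fin n, StrictMono i → ¬ Φ (p ∘ i))

/-- Every sequence of `N` points of `ℝ^d` contains a `Φ`-homogeneous subsequence of length `n`. -/
def ForcesHomogeneous {k d : ℕ} (Φ : (Fin k → Fin d → ℝ) → Prop) (n N : ℕ) : Prop :=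
  ∀ p : Fin N → Fin d → ℝ, ∃ s : Fin n → Fin N, StrictMono s ∧ IsHomogeneous Φ (p ∘ s)

/-- The Ramsey function `R_Φ(n)`: the smallest `N` such that every point sequence of length `N`
contains a `Φ`-homogeneous subsequence of length `n`. Such an `N` always exists, by Ramsey's
theorem; see `exists_forcesHomogeneous` below. -/
noncomputable def ramseyFun {k d : ℕ} (Φ : (Fin k → Fin d → ℝ) → Prop) (n : ℕ) : ℕ :=
  sInf {N : ℕ | ForcesHomogeneous Φ n N}

/-- Ramsey's theorem for two-colourings of the `k`-subsets of a finite set of naturals. -/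
theorem ramsey_finset (k : ℕ) : ∀ n : ℕ, ∃ N : ℕ, ∀ (χ : Finset ℕ → Prop) (S : Finset ℕ),
    N ≤ S.card → ∃ T ⊆ S, T.card = n ∧
      ((∀ A ⊆ T, A.card = k → χ A) ∨ (∀ A ⊆ T, A.card = k → ¬ χ A)) := by
  induction k with
  | zero =>
    intro n
    refine ⟨n, fun χ S hS => ?_⟩
    obtain ⟨T, hT, hc⟩ := Finset.exists_subset_card_eq hS
    refine ⟨T, hT, hc, ?_⟩
    by_cases h : χ ∅
    · left
      intro A _ hA
      rw [Finset.card_eq_zero.mp hA]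
      exact h
    · right
      intro A _ hA
      rw [Finset.card_eq_zero.mp hA]
      exact h
  | succ k ih =>
    have key : ∀ m : ℕ, ∃ M : ℕ, ∀ (χ : Finset ℕ → Prop) (S : Finset ℕ), M ≤ S.card →
        ∃ T ⊆ S, T.card = m ∧ ∃ f : ℕ → Prop, ∀ a ∈ T, ∀ B ⊆ T, B.card = k →
          (∀ b ∈ B, a < b) → (χ (insert a B) ↔ f a) := by
      intro m
      induction m with
      | zero =>
        refine ⟨0, fun χ S _ => ⟨∅, by simp, by simp, fun _ => True, by simp⟩⟩
      | succ m ihm =>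
        obtain ⟨M, hM⟩ := ihm
        obtain ⟨N, hN⟩ := ih M
        refine ⟨N + 1, fun χ S hS => ?_⟩
        have hne : S.Nonempty := Finset.card_pos.mp (by omega)
        set a := S.min' hne with ha
        have haS : a ∈ S := S.min'_mem hne
        obtain ⟨U, hU, hUc, hUh⟩ := hN (fun B => χ (insert a B)) (S.erase a)
          (by rw [Finset.card_erase_of_mem haS]; omega)
        obtain ⟨T, hT, hTc, f, hf⟩ := hM χ U hUc.ge
        have hTS : ∀ b ∈ T, a < b := fun b hb => by
          have h1 := Finset.mem_erase.mp (hU (hT hb))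
          exact lt_of_le_of_ne (S.min'_le b h1.2) (Ne.symm h1.1)
        have haT : a ∉ T := fun h => lt_irrefl _ (hTS a h)
        obtain ⟨c, hc⟩ : ∃ c : Prop, ∀ B ⊆ U, B.card = k → (χ (insert a B) ↔ c) := by
          rcases hUh with h | h
          · exact ⟨True, fun B hB hBc => iff_true_intro (h B hB hBc)⟩
          · exact ⟨False, fun B hB hBc => iff_false_intro (h B hB hBc)⟩
        refine ⟨insert a T, ?_, by rw [Finset.card_insert_of_notMem haT, hTc],
          Function.update f a c, ?_⟩
        · intro b hb
          rcases Finset.mem_insert.mp hb with rfl | hb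
          · exact haS
          · exact Finset.mem_of_mem_erase (hU (hT hb))
        · intro b hb B hB hBc hlt
          have haB : a ∉ B := fun h => by
            have h1 := hlt a h
            rcases Finset.mem_insert.mp hb with h2 | h2
            · omega
            · have := hTS b h2
              omega
          have hBT : B ⊆ T := fun x hx => by
            rcases Finset.mem_insert.mp (hB hx) with h2 | h2
            · exact absurd (h2 ▸ hx) haB
            · exact h2
          rcases Finset.mem_insert.mp hb with h2 | h2
          · rw [h2, Function.update_self]
            exact hc B (hBT.trans hT) hBc
          · rw [Function.update_of_ne (ne_of_gt (hTS b h2))]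
            exact hf b h2 B hBT hBc hlt
    intro n
    obtain ⟨M, hM⟩ := key (2 * n)
    refine ⟨M, fun χ S hS => ?_⟩
    obtain ⟨T, hT, hTc, f, hf⟩ := hM χ S hS
    classical
    have hsplit : ∀ A ⊆ T, A.card = k + 1 → ∃ a ∈ A, (χ A ↔ f a) := by
      intro A hA hAc
      have hne : A.Nonempty := Finset.card_pos.mp (by omega)
      refine ⟨A.min' hne, A.min'_mem hne, ?_⟩
      have h := hf (A.min' hne) (hA (A.min'_mem hne)) (A.erase (A.min' hne))
        ((Finset.erase_subset _ _).trans hA)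
        (by rw [Finset.card_erase_of_mem (A.min'_mem hne)]; omega)
        (fun b hb => A.min'_lt_of_mem_erase_min' hne hb)
      rwa [Finset.insert_erase (A.min'_mem hne)] at h
    have hcard := Finset.card_filter_add_card_filter_not (s := T) f
    rcases le_or_gt n (T.filter f).card with h | h
    · obtain ⟨V, hV, hVc⟩ := Finset.exists_subset_card_eq h
      refine ⟨V, (hV.trans (Finset.filter_subset _ _)).trans hT, hVc, Or.inl ?_⟩
      intro A hA hAc
      obtain ⟨a, ha, hiff⟩ := hsplit A (hA.trans (hV.trans (Finset.filter_subset _ _))) hAc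
      exact hiff.mpr (Finset.mem_filter.mp (hV (hA ha))).2
    · obtain ⟨V, hV, hVc⟩ := Finset.exists_subset_card_eq
        (show n ≤ (T.filter (fun a => ¬ f a)).card by omega)
      refine ⟨V, (hV.trans (Finset.filter_subset _ _)).trans hT, hVc, Or.inr ?_⟩
      intro A hA hAc
      obtain ⟨a, ha, hiff⟩ := hsplit A (hA.trans (hV.trans (Finset.filter_subset _ _))) hAc
      exact fun h => (Finset.mem_filter.mp (hV (hA ha))).2 (hiff.mp h)

/-- The minimum in the definition of `ramseyFun` is over a nonempty set. -/
theorem exists_forcesHomogeneous {k d : ℕ} (Φ : (Fin k → Fin d → ℝ) → Prop) (n : ℕ) :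
    ∃ N : ℕ, ForcesHomogeneous Φ n N := by
  obtain ⟨N, hN⟩ := ramsey_finset k n
  refine ⟨N, fun p => ?_⟩
  obtain ⟨T, hT, hTc, hh⟩ := hN
    (fun A => ∃ i : Fin k → Fin N, StrictMono i ∧ A = Finset.univ.image (fun j => (i j : ℕ)) ∧
      Φ (p ∘ i)) (Finset.range N) (by simp)
  have hlt : ∀ x : Fin n, T.orderEmbOfFin hTc x < N := fun x =>
    Finset.mem_range.mp (hT (Finset.orderEmbOfFin_mem T hTc x))
  refine ⟨fun x => ⟨T.orderEmbOfFin hTc x, hlt x⟩, fun x y hxy => ?_, ?_⟩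
  · exact (T.orderEmbOfFin hTc).strictMono hxy
  · set s : Fin n → Fin N := fun x => ⟨T.orderEmbOfFin hTc x, hlt x⟩ with hs
    have hsm : StrictMono s := fun x y hxy => (T.orderEmbOfFin hTc).strictMono hxy
    have hsub : ∀ i : Fin k → Fin n,
        Finset.univ.image (fun j => ((s ∘ i) j : ℕ)) ⊆ T := by
      intro i x hx
      obtain ⟨j, _, rfl⟩ := Finset.mem_image.mp hx
      exact Finset.orderEmbOfFin_mem T hTc (i j)
    have hcd : ∀ i : Fin k → Fin N, StrictMono i →
        (Finset.univ.image (fun j => (i j : ℕ))).card = k := by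
      intro i hi
      have hinj : Function.Injective (fun j => (i j : ℕ)) := Fin.val_injective.comp hi.injective
      rw [Finset.card_image_of_injective _ hinj]
      simp
    rcases hh with h | h
    · left
      intro i hi
      obtain ⟨i', hi', heq, hΦ⟩ := h _ (hsub i) (hcd _ (hsm.comp hi))
      have hv : (fun j => ((s ∘ i) j : ℕ)) = fun j => (i' j : ℕ) := by
        have h1 : StrictMono (fun j => ((s ∘ i) j : ℕ)) := hsm.comp hi
        have h2 : StrictMono (fun j => (i' j : ℕ)) := hi'
        have e1 := Finset.orderEmbOfFin_unique (hcd _ (hsm.comp hi))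
          (fun j => Finset.mem_image_of_mem _ (Finset.mem_univ j)) h1
        have e2 := Finset.orderEmbOfFin_unique (hcd _ (hsm.comp hi)) (f := fun j => (i' j : ℕ))
          (fun j => by rw [heq]; exact Finset.mem_image_of_mem _ (Finset.mem_univ j)) h2
        rw [e1, e2]
      have : s ∘ i = i' := funext fun j => Fin.ext (congrFun hv j)
      rw [Function.comp_assoc, this]
      exact hΦ
    · right
      intro i hi hΦ
      exact h _ (hsub i) (hcd _ (hsm.comp hi)) ⟨s ∘ i, hsm.comp hi, rfl, hΦ⟩

/-! The proof is the Erdős–Hajnal stepping-up construction carried out with points. For an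
increasing tuple of integers, take the top binary digit in which each consecutive pair differs. This
turns a colouring of tuples of numbers below `N` into a colouring of tuples, longer by one, of
numbers below `2 ^ N`: monotone difference sequences inherit the old colour, and otherwise local
maxima and minima at the beginning get opposite colours. A large homogeneous set then has a long
monotone run of differences, hence yields a homogeneous set downstairs; its size only doubles, up to
an additive constant (`NoHomogeneous.step`).

Geometrically, the number `i` becomes the sum of `v s * L ^ h s` over its binary digits equal to
`1`. For large `L`, the difference of two points is dominated by the term at their top differing
digit `t`. With `v t = (1, p t)`, comparing first coordinates compares differing positions, and the
slope tends to `p t`. So one extra dimension suffices to define the stepped-up colouring from the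
old predicate (`exists_realizes_step`). Since slopes only approximate the old points, the induction
carries configurations whose colours survive small perturbations (`Realizes`).

The induction starts on the line with arity `4` and a double exponential. On triples below `2 ^ m`,
convexity of `spread` has no homogeneous set of size `m + 2` (`noHomogeneous_convexColor`). Its
stepped-up colouring is realized on the line by taking `spread` as the exponents `h`, so that
convexity of exponents becomes log-convexity of gaps (`exists_realizes_base`). Each further
dimension adds one to the arity and one exponential. -/

/-! ### Closure properties of semialgebraic predicates -/

/-- A real function of `k` points of `ℝ^d` given by a polynomial in the coordinates. -/
def IsPolyFun {k d : ℕ} (g : (Fin k → Fin d → ℝ) → ℝ) : Prop :=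
  ∃ f : MvPolynomial (Fin k × Fin d) ℝ, ∀ x, g x = MvPolynomial.eval (fun ij => x ij.1 ij.2) f

namespace IsPolyFun

variable {k d : ℕ} {f g : (Fin k → Fin d → ℝ) → ℝ}

theorem const (c : ℝ) : IsPolyFun (fun _ : Fin k → Fin d → ℝ => c) :=
  ⟨MvPolynomial.C c, by simp⟩

theorem coord (i : Fin k) (j : Fin d) : IsPolyFun (fun x : Fin k → Fin d → ℝ => x i j) :=
  ⟨MvPolynomial.X (i, j), by simp⟩

theorem add (hf : IsPolyFun f) (hg : IsPolyFun g) : IsPolyFun (fun x => f x + g x) := by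
  obtain ⟨p, hp⟩ := hf
  obtain ⟨q, hq⟩ := hg
  exact ⟨p + q, fun x => by simp [hp, hq]⟩

theorem sub (hf : IsPolyFun f) (hg : IsPolyFun g) : IsPolyFun (fun x => f x - g x) := by
  obtain ⟨p, hp⟩ := hf
  obtain ⟨q, hq⟩ := hg
  exact ⟨p - q, fun x => by simp [hp, hq]⟩

theorem mul (hf : IsPolyFun f) (hg : IsPolyFun g) : IsPolyFun (fun x => f x * g x) := by
  obtain ⟨p, hp⟩ := hf
  obtain ⟨q, hq⟩ := hg
  exact ⟨p * q, fun x => by simp [hp, hq]⟩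

end IsPolyFun

namespace IsSemialgebraic

variable {k d : ℕ} {Φ Ψ : (Fin k → Fin d → ℝ) → Prop}

theorem congr (hΦ : IsSemialgebraic Φ) (h : ∀ x, Ψ x ↔ Φ x) : IsSemialgebraic Ψ := by
  obtain ⟨t, φ, f, hf⟩ := hΦ
  exact ⟨t, φ, f, fun x => (h x).trans (hf x)⟩

theorem true : IsSemialgebraic (fun _ : Fin k → Fin d → ℝ => True) :=
  ⟨0, fun _ => True, Fin.elim0, by simp⟩

theorem not (hΦ : IsSemialgebraic Φ) : IsSemialgebraic (fun x => ¬ Φ x) := by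
  obtain ⟨t, φ, f, hf⟩ := hΦ
  exact ⟨t, fun a => ¬ φ a, f, fun x => not_congr (hf x)⟩

theorem and (hΦ : IsSemialgebraic Φ) (hΨ : IsSemialgebraic Ψ) :
    IsSemialgebraic (fun x => Φ x ∧ Ψ x) := by
  obtain ⟨t, φ, f, hf⟩ := hΦ
  obtain ⟨s, ψ, g, hg⟩ := hΨ
  refine ⟨t + s, fun a => φ (fun l => a (Fin.castAdd s l)) ∧ ψ (fun l => a (Fin.natAdd t l)),
    Fin.append f g, fun x => ?_⟩
  simp only [Fin.append_left, Fin.append_right, hf x, hg x]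

theorem or (hΦ : IsSemialgebraic Φ) (hΨ : IsSemialgebraic Ψ) :
    IsSemialgebraic (fun x => Φ x ∨ Ψ x) :=
  (hΦ.not.and hΨ.not).not.congr fun x => by tauto

theorem forall_fin : ∀ {r : ℕ} {P : Fin r → (Fin k → Fin d → ℝ) → Prop},
    (∀ j, IsSemialgebraic (P j)) → IsSemialgebraic (fun x => ∀ j, P j x)
  | 0, _, _ => true.congr fun x => by simp
  | _ + 1, _, h => ((h 0).and (forall_fin fun j => h j.succ)).congr fun x => Fin.forall_fin_succ

theorem le {f g : (Fin k → Fin d → ℝ) → ℝ} (hf : IsPolyFun f) (hg : IsPolyFun g) :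
    IsSemialgebraic (fun x => f x ≤ g x) := by
  obtain ⟨p, hp⟩ := hg.sub hf
  exact ⟨1, fun a => a 0, fun _ => p, fun x => by simp only [← hp, sub_nonneg]⟩

theorem lt {f g : (Fin k → Fin d → ℝ) → ℝ} (hf : IsPolyFun f) (hg : IsPolyFun g) :
    IsSemialgebraic (fun x => f x < g x) :=
  (le hg hf).not.congr fun _ => not_le.symm

end IsSemialgebraic

/-- A polynomial evaluated at quotients of polynomial functions with positive denominators becomes
a polynomial function after multiplication with a positive polynomial function. -/
theorem exists_isPolyFun_eval_div {k d : ℕ} {σ : Type*} {num den : σ → (Fin k → Fin d → ℝ) → ℝ}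
    (hnum : ∀ s, IsPolyFun (num s)) (hden : ∀ s, IsPolyFun (den s)) (f : MvPolynomial σ ℝ) :
    ∃ g h : (Fin k → Fin d → ℝ) → ℝ, IsPolyFun g ∧ IsPolyFun h ∧ ∀ x, (∀ s, 0 < den s x) →
      0 < h x ∧ MvPolynomial.eval (fun s => num s x / den s x) f * h x = g x := by
  induction f using MvPolynomial.induction_on with
  | C a => exact ⟨_, _, .const a, .const 1, fun x _ => by simp⟩
  | add p q hp hq =>
    obtain ⟨g, h, hg, hh, H⟩ := hp
    obtain ⟨g', h', hg', hh', H'⟩ := hq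
    refine ⟨_, _, (hg.mul hh').add (hg'.mul hh), hh.mul hh', fun x hx => ?_⟩
    obtain ⟨h1, h2⟩ := H x hx
    obtain ⟨h3, h4⟩ := H' x hx
    refine ⟨mul_pos h1 h3, ?_⟩
    rw [← h2, ← h4, map_add]
    ring
  | mul_X p s hp =>
    obtain ⟨g, h, hg, hh, H⟩ := hp
    refine ⟨_, _, hg.mul (hnum s), hh.mul (hden s), fun x hx => ?_⟩
    obtain ⟨h1, h2⟩ := H x hx
    refine ⟨mul_pos h1 (hx s), ?_⟩
    have := (hx s).ne'
    rw [← h2, map_mul, MvPolynomial.eval_X]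
    field_simp

/-- Positivity of the denominators is part of the predicate, so clearing them preserves the sign of
each polynomial. -/
theorem IsSemialgebraic.comp_div {k d k' d' : ℕ} {Φ : (Fin k' → Fin d' → ℝ) → Prop}
    (hΦ : IsSemialgebraic Φ) {num : Fin k' → Fin d' → (Fin k → Fin d → ℝ) → ℝ}
    {den : Fin k' → (Fin k → Fin d → ℝ) → ℝ}
    (hnum : ∀ i j, IsPolyFun (num i j)) (hden : ∀ i, IsPolyFun (den i)) :
    IsSemialgebraic (fun x => (∀ i, 0 < den i x) ∧ Φ (fun i j => num i j x / den i x)) := by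
  obtain ⟨t, φ, f, hf⟩ := hΦ
  choose g h hg hh H using fun l => exists_isPolyFun_eval_div
    (num := fun ij : Fin k' × Fin d' => num ij.1 ij.2) (den := fun ij => den ij.1)
    (fun ij => hnum ij.1 ij.2) (fun ij => hden ij.1) (f l)
  choose G hG using hg
  have hS : IsSemialgebraic (fun x => φ (fun l => 0 ≤ g l x)) :=
    ⟨t, φ, G, fun x => by simp only [hG]⟩
  refine ((forall_fin fun i => lt (.const 0) (hden i)).and hS).congr fun x => ?_
  refine and_congr_right fun hx => ?_
  rw [hf]
  have : ∀ l, (0 ≤ MvPolynomial.eval (fun ij : Fin k' × Fin d' =>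
      num ij.1 ij.2 x / den ij.1 x) (f l)) = (0 ≤ g l x) := fun l => by
    obtain ⟨h1, h2⟩ := H l x fun ij => hx ij.1
    rw [← h2, mul_nonneg_iff_of_pos_right h1]
  simp only [this]

/-! ### Top differing binary digits -/

/-- The position of the highest binary digit in which `a` and `b` differ. -/
noncomputable def topDiff (a b : ℕ) : ℕ := sInf {t | a / 2 ^ (t + 1) = b / 2 ^ (t + 1)}

theorem topDiff_le_iff {a b t : ℕ} : topDiff a b ≤ t ↔ a / 2 ^ (t + 1) = b / 2 ^ (t + 1) := by
  constructor
  · intro h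
    have hne : {t | a / 2 ^ (t + 1) = b / 2 ^ (t + 1)}.Nonempty := by
      refine ⟨a + b, ?_⟩
      have h1 : a + b + 1 < 2 ^ (a + b + 1) := Nat.lt_two_pow_self
      simp only [Set.mem_ofPred_eq]
      rw [Nat.div_eq_of_lt (by omega), Nat.div_eq_of_lt (by omega)]
    have h1 : a / 2 ^ (topDiff a b + 1) = b / 2 ^ (topDiff a b + 1) := Nat.sInf_mem hne
    have h2 : 2 ^ (t + 1) = 2 ^ (topDiff a b + 1) * 2 ^ (t - topDiff a b) := by
      rw [← pow_add]
      congr 1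
      omega
    rw [h2, ← Nat.div_div_eq_div_mul, ← Nat.div_div_eq_div_mul, h1]
  · exact fun h => Nat.sInf_le h

theorem div_two_pow_topDiff_lt {a b : ℕ} (h : a < b) :
    a / 2 ^ topDiff a b < b / 2 ^ topDiff a b := by
  refine lt_of_le_of_ne (Nat.div_le_div_right h.le) fun he => ?_
  rcases hd : topDiff a b with _ | t
  · rw [hd] at he
    simp at he
    omega
  · rw [hd] at he
    have := topDiff_le_iff.mpr he
    omega

/-- The binary digit of `a` at position `t`. -/
def bit (t a : ℕ) : ℕ := a / 2 ^ t % 2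

theorem bit_topDiff {a b : ℕ} (h : a < b) :
    bit (topDiff a b) a = 0 ∧ bit (topDiff a b) b = 1 := by
  have h1 := div_two_pow_topDiff_lt h
  have h2 := topDiff_le_iff.mp (le_refl (topDiff a b))
  rw [pow_succ, ← Nat.div_div_eq_div_mul, ← Nat.div_div_eq_div_mul] at h2
  unfold bit
  omega

theorem bit_eq_of_topDiff_lt {a b t : ℕ} (h : topDiff a b < t) : bit t a = bit t b := by
  obtain ⟨s, rfl⟩ : ∃ s, t = s + 1 := ⟨t - 1, by omega⟩
  unfold bit
  rw [topDiff_le_iff.mp (show topDiff a b ≤ s by omega)]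

theorem topDiff_lt {a b N : ℕ} (hab : a < b) (hb : b < 2 ^ N) : topDiff a b < N := by
  by_contra h
  have h1 := div_two_pow_topDiff_lt hab
  have h2 : 2 ^ N ≤ 2 ^ topDiff a b := Nat.pow_le_pow_right (by norm_num) (by omega)
  rw [Nat.div_eq_of_lt (a := b) (by omega)] at h1
  exact Nat.not_lt_zero _ h1

/-- At a common top position `b` would need digit `1` as the larger number of the first pair and `0`
as the smaller one of the second. -/
theorem topDiff_ne {a b c : ℕ} (hab : a < b) (hbc : b < c) : topDiff a b ≠ topDiff b c := by
  intro h
  have h1 := (bit_topDiff hab).2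
  have h2 := (bit_topDiff hbc).1
  rw [h] at h1
  omega

/-- Truncation of low digits is monotone, so the truncations of `a` and `c` agree exactly when that
of `b` agrees with both. -/
theorem topDiff_eq_max {a b c : ℕ} (hab : a ≤ b) (hbc : b ≤ c) :
    topDiff a c = max (topDiff a b) (topDiff b c) := by
  refine eq_of_forall_ge_iff fun t => ?_
  rw [max_le_iff, topDiff_le_iff, topDiff_le_iff, topDiff_le_iff]
  have h1 : a / 2 ^ (t + 1) ≤ b / 2 ^ (t + 1) := Nat.div_le_div_right hab
  have h2 : b / 2 ^ (t + 1) ≤ c / 2 ^ (t + 1) := Nat.div_le_div_right hbc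
  omega

/-! ### Stepping up colourings -/

/-- No `n` of the numbers below `N` form a homogeneous set for the colouring `χ` of `k`-tuples. -/
def NoHomogeneous {k : ℕ} (χ : (Fin k → ℕ) → Prop) (N n : ℕ) : Prop :=
  ∀ s : ℕ → ℕ, (∀ x y, x < y → y < n → s x < s y) → (∀ x < n, s x < N) →
    ¬ ((∀ i : Fin k → ℕ, StrictMono i → (∀ x, i x < n) → χ (s ∘ i)) ∨
      (∀ i : Fin k → ℕ, StrictMono i → (∀ x, i x < n) → ¬ χ (s ∘ i)))

theorem NoHomogeneous.mono {k : ℕ} {χ : (Fin k → ℕ) → Prop} {N n n' : ℕ}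
    (h : NoHomogeneous χ N n) (hn : n ≤ n') : NoHomogeneous χ N n' := by
  intro s hs hN hh
  refine h s (fun x y hxy hy => hs x y hxy (by omega)) (fun x hx => hN x (by omega)) ?_
  rcases hh with hh | hh
  · exact Or.inl fun i hi hx => hh i hi fun x => (hx x).trans_le hn
  · exact Or.inr fun i hi hx => hh i hi fun x => (hx x).trans_le hn

/-- The top differing positions of consecutive entries. -/
noncomputable def diffs {k : ℕ} (i : Fin (k + 1) → ℕ) (j : Fin k) : ℕ :=
  topDiff (i j.castSucc) (i j.succ)

/-- The stepped-up colouring of `χ`. -/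
def stepColor {m : ℕ} (χ : (Fin (m + 3) → ℕ) → Prop) (i : Fin (m + 4) → ℕ) : Prop :=
  (StrictMono (diffs i) ∧ χ (diffs i)) ∨ (StrictAnti (diffs i) ∧ χ (diffs i ∘ Fin.rev)) ∨
    (diffs i 0 < diffs i 1 ∧ diffs i 2 < diffs i 1)

theorem stepColor_of_strictMono {m : ℕ} {χ : (Fin (m + 3) → ℕ) → Prop} {i : Fin (m + 4) → ℕ}
    (h : StrictMono (diffs i)) : stepColor χ i ↔ χ (diffs i) := by
  have h1 : diffs i 1 < diffs i 2 := h (by simp [Fin.lt_def, Nat.mod_eq_of_lt])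
  have h2 : ¬ StrictAnti (diffs i) := fun h' => by
    have : diffs i 2 < diffs i 1 := h' (by simp [Fin.lt_def, Nat.mod_eq_of_lt])
    omega
  have h3 : ¬ diffs i 2 < diffs i 1 := by omega
  simp [stepColor, h, h2, h3]

theorem stepColor_of_strictAnti {m : ℕ} {χ : (Fin (m + 3) → ℕ) → Prop} {i : Fin (m + 4) → ℕ}
    (h : StrictAnti (diffs i)) : stepColor χ i ↔ χ (diffs i ∘ Fin.rev) := by
  have h1 : diffs i 1 < diffs i 0 := h (by simp)
  have h2 : ¬ StrictMono (diffs i) := fun h' => by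
    have : diffs i 0 < diffs i 1 := h' (by simp)
    omega
  have h3 : ¬ diffs i 0 < diffs i 1 := by omega
  simp [stepColor, h, h2, h3]

section Runs

variable {a : ℕ → ℕ} {M : ℕ}

theorem topDiff_eq_of_increasing {b n : ℕ} (ha : ∀ x y, x < y → y < M → a x < a y)
    (hb : b + n < M)
    (hinc : ∀ x y, x < y → y < n → topDiff (a (b + x)) (a (b + x + 1)) <
      topDiff (a (b + y)) (a (b + y + 1)))
    {u v : ℕ} (huv : u ≤ v) (hv : v < n) :
    topDiff (a (b + u)) (a (b + v + 1)) = topDiff (a (b + v)) (a (b + v + 1)) := by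
  induction v, huv using Nat.le_induction with
  | base => rfl
  | succ w huw ih =>
    rw [topDiff_eq_max (b := a (b + w + 1)) (ha _ _ (by omega) (by omega)).le
      (ha _ _ (by omega) (by omega)).le, ih (by omega)]
    exact max_eq_right (hinc w (w + 1) (by omega) hv).le

theorem topDiff_eq_of_decreasing {b n : ℕ} (ha : ∀ x y, x < y → y < M → a x < a y)
    (hb : b + n < M)
    (hdec : ∀ x y, x < y → y < n → topDiff (a (b + y)) (a (b + y + 1)) <
      topDiff (a (b + x)) (a (b + x + 1)))
    {u v : ℕ} (huv : u ≤ v) (hv : v < n) :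
    topDiff (a (b + u)) (a (b + v + 1)) = topDiff (a (b + u)) (a (b + u + 1)) := by
  induction v, huv using Nat.le_induction with
  | base => rfl
  | succ w huw ih =>
    rw [topDiff_eq_max (b := a (b + w + 1)) (ha _ _ (by omega) (by omega)).le
      (ha _ _ (by omega) (by omega)).le, ih (by omega)]
    exact max_eq_left (hdec u (w + 1) (by omega) hv).le

end Runs

/-- An increasing run of differences turns tuples of differences into differences of tuples. -/
theorem exists_tuple_of_increasing {a : ℕ → ℕ} {M b n k : ℕ}
    (ha : ∀ x y, x < y → y < M → a x < a y) (hb : b + n < M)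
    (hinc : ∀ x y, x < y → y < n → topDiff (a (b + x)) (a (b + x + 1)) <
      topDiff (a (b + y)) (a (b + y + 1)))
    (i : Fin (k + 1) → ℕ) (hi : StrictMono i) (hin : ∀ x, i x < n) :
    ∃ t : Fin (k + 2) → ℕ, StrictMono t ∧ (∀ x, t x < M) ∧
      diffs (a ∘ t) = (fun x => topDiff (a (b + x)) (a (b + x + 1))) ∘ i := by
  -- Over a block of increasing differences the last one dominates, so each block ends just after
  -- the selected difference.
  refine ⟨Fin.cons b fun j => b + i j + 1, ?_, ?_, ?_⟩
  · rw [Fin.strictMono_iff_lt_succ]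
    intro j
    refine Fin.cases ?_ (fun j => ?_) j
    · simp
    · have := hi (Fin.castSucc_lt_succ (i := j))
      simp
      exact this
  · intro x
    refine Fin.cases ?_ (fun j => ?_) x
    · simp
      omega
    · have := hin j
      simp
      omega
  · funext j
    refine Fin.cases ?_ (fun j => ?_) j
    · simp [diffs]
      exact topDiff_eq_of_increasing ha hb hinc (Nat.zero_le _) (hin 0)
    · have := hi (Fin.castSucc_lt_succ (i := j))
      simp only [diffs, Function.comp_apply, ← Fin.succ_castSucc, Fin.cons_succ]
      exact topDiff_eq_of_increasing ha hb hinc (u := i j.castSucc + 1) (by omega) (hin j.succ)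

theorem exists_tuple_of_decreasing {a : ℕ → ℕ} {M b n k : ℕ}
    (ha : ∀ x y, x < y → y < M → a x < a y) (hb : b + n < M)
    (hdec : ∀ x y, x < y → y < n → topDiff (a (b + y)) (a (b + y + 1)) <
      topDiff (a (b + x)) (a (b + x + 1)))
    (i : Fin (k + 1) → ℕ) (hi : StrictMono i) (hin : ∀ x, i x < n) :
    ∃ t : Fin (k + 2) → ℕ, StrictMono t ∧ (∀ x, t x < M) ∧
      diffs (a ∘ t) = (fun x => topDiff (a (b + x)) (a (b + x + 1))) ∘ i := by
  -- Over a block of decreasing differences the first one dominates, so each block starts at the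
  -- selected difference.
  refine ⟨Fin.snoc (fun j => b + i j) (b + n), ?_, ?_, ?_⟩
  · rw [Fin.strictMono_iff_lt_succ]
    intro j
    refine Fin.lastCases ?_ (fun j => ?_) j
    · have := hin (Fin.last k)
      simp
      omega
    · have := hi (Fin.castSucc_lt_succ (i := j))
      simp only [Fin.succ_castSucc, Fin.snoc_castSucc]
      omega
  · intro x
    refine Fin.lastCases ?_ (fun j => ?_) x
    · simp
      omega
    · have := hin j
      simp
      omega
  · funext j
    refine Fin.lastCases ?_ (fun j => ?_) j
    · have := hin (Fin.last k)
      have h := topDiff_eq_of_decreasing ha hb hdec (u := i (Fin.last k)) (v := n - 1)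
        (by omega) (by omega)
      rw [show b + (n - 1) + 1 = b + n by omega] at h
      simp only [diffs, Function.comp_apply, Fin.succ_last, Fin.snoc_last, Fin.snoc_castSucc]
      exact h
    · have h1 := hi (Fin.castSucc_lt_succ (i := j))
      have h2 := hin j.succ
      have h := topDiff_eq_of_decreasing ha hb hdec (u := i j.castSucc) (v := i j.succ - 1)
        (by omega) (by omega)
      rw [show b + (i j.succ - 1) + 1 = b + i j.succ by omega] at h
      simp only [diffs, Function.comp_apply, Fin.succ_castSucc, Fin.snoc_castSucc]
      exact h

/-- A sequence without local minima contains a long increasing or a long decreasing run. -/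
theorem exists_run {α : Type*} [LinearOrder α] {e : ℕ → α} {n : ℕ}
    (hne : ∀ j, j ≤ 2 * n → e j ≠ e (j + 1))
    (hmin : ∀ j, j < 2 * n + 1 → ¬ (e (j + 1) < e j ∧ e (j + 1) < e (j + 2))) :
    ∃ b ≤ n, (∀ x y, x < y → y < n → e (b + x) < e (b + y)) ∨
      (∀ x y, x < y → y < n → e (b + y) < e (b + x)) := by
  by_cases h : ∀ j < n, e j < e (j + 1)
  · refine ⟨0, Nat.zero_le _, Or.inl fun x y hxy => ?_⟩
    induction y, hxy using Nat.le_induction with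
    | base => exact fun hy => by simpa using h x (by omega)
    | succ y hxy ih => exact fun hy => (ih (by omega)).trans (by simpa using h y (by omega))
  -- Without local minima a descent can never turn upwards; one starting before `n` leaves room for
  -- `n` decreasing terms.
  · push Not at h
    obtain ⟨b, hb, hle⟩ := h
    have hdesc : ∀ x, x < n → e (b + x + 1) < e (b + x) := by
      intro x
      induction x with
      | zero => exact fun _ => lt_of_le_of_ne hle (hne b (by omega)).symm
      | succ x ih =>
        intro hx
        have h1 := ih (by omega)
        have h2 : ¬ e (b + x + 1) < e (b + x + 2) := fun h2 => hmin (b + x) (by omega) ⟨h1, h2⟩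
        exact lt_of_le_of_ne (not_lt.mp h2) (hne (b + x + 1) (by omega)).symm
    refine ⟨b, hb.le, Or.inr fun x y hxy => ?_⟩
    induction y, hxy using Nat.le_induction with
    | base => exact fun hy => hdesc x (by omega)
    | succ y hxy ih => exact fun hy => (hdesc y (by omega)).trans (ih (by omega))

theorem not_homogeneous_of_run {m : ℕ} {χ : (Fin (m + 3) → ℕ) → Prop} {N n M b : ℕ}
    (h : NoHomogeneous χ N n) {a : ℕ → ℕ} (ha : ∀ x y, x < y → y < M → a x < a y)
    (haN : ∀ x < M, a x < 2 ^ N) (hb : b + n < M)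
    (hrun : (∀ x y, x < y → y < n → topDiff (a (b + x)) (a (b + x + 1)) <
        topDiff (a (b + y)) (a (b + y + 1))) ∨
      (∀ x y, x < y → y < n → topDiff (a (b + y)) (a (b + y + 1)) <
        topDiff (a (b + x)) (a (b + x + 1)))) :
    ¬ ((∀ i : Fin (m + 4) → ℕ, StrictMono i → (∀ x, i x < M) → stepColor χ (a ∘ i)) ∨
      (∀ i : Fin (m + 4) → ℕ, StrictMono i → (∀ x, i x < M) → ¬ stepColor χ (a ∘ i))) := by
  set e : ℕ → ℕ := fun x => topDiff (a (b + x)) (a (b + x + 1)) with he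
  have heN : ∀ x < n, e x < N := fun x hx =>
    topDiff_lt (ha _ _ (by omega) (by omega)) (haN _ (by omega))
  obtain ⟨s, hs, hsN, hst⟩ : ∃ s : ℕ → ℕ, (∀ x y, x < y → y < n → s x < s y) ∧
      (∀ x < n, s x < N) ∧ ∀ i : Fin (m + 3) → ℕ, StrictMono i → (∀ x, i x < n) →
        ∃ t : Fin (m + 4) → ℕ, StrictMono t ∧ (∀ x, t x < M) ∧
          (stepColor χ (a ∘ t) ↔ χ (s ∘ i)) := by
    rcases hrun with hinc | hdec
    · refine ⟨e, hinc, heN, fun i hi hin => ?_⟩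
      obtain ⟨t, ht, htM, hd⟩ := exists_tuple_of_increasing ha hb hinc i hi hin
      refine ⟨t, ht, htM, ?_⟩
      rw [stepColor_of_strictMono, hd]
      rw [hd]
      exact fun x y hxy => hinc _ _ (hi hxy) (hin y)
    -- A decreasing run is read backwards to give an increasing sequence downstairs.
    · refine ⟨fun x => e (n - 1 - x), fun x y hxy hy => hdec _ _ (by omega) (by omega),
        fun x hx => heN _ (by omega), fun i hi hin => ?_⟩
      obtain ⟨t, ht, htM, hd⟩ := exists_tuple_of_decreasing ha hb hdec
        (fun x => n - 1 - i x.rev)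
        (fun x y hxy => by
          have h1 := hi (Fin.rev_lt_rev.mpr hxy)
          have h2 := hin x.rev
          simp only
          omega)
        (fun x => by
          have := hin x.rev
          omega)
      refine ⟨t, ht, htM, ?_⟩
      rw [stepColor_of_strictAnti, hd]
      · have : ((fun x => topDiff (a (b + x)) (a (b + x + 1))) ∘ fun x => n - 1 - i x.rev) ∘
            Fin.rev = (fun x => e (n - 1 - x)) ∘ i := by
          funext x
          simp [he]
        rw [this]
      · rw [hd]
        intro x y hxy
        have h1 := hi (Fin.rev_lt_rev.mpr hxy)
        have h2 := hin x.rev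
        exact hdec (n - 1 - i x.rev) (n - 1 - i y.rev) (by omega) (by omega)
  intro hh
  refine h s hs hsN ?_
  rcases hh with hh | hh
  · refine Or.inl fun i hi hin => ?_
    obtain ⟨t, ht, htM, hiff⟩ := hst i hi hin
    exact hiff.mp (hh t ht htM)
  · refine Or.inr fun i hi hin hχ => ?_
    obtain ⟨t, ht, htM, hiff⟩ := hst i hi hin
    exact hh t ht htM (hiff.mpr hχ)

/-- A window of consecutive entries starting with a local maximum of differences is coloured true,
one starting with a local minimum false. A homogeneous sequence thus avoids one of the two kinds,
which forces a monotone run of length `n`. -/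
theorem NoHomogeneous.step {m : ℕ} {χ : (Fin (m + 3) → ℕ) → Prop} {N n : ℕ}
    (h : NoHomogeneous χ N n) : NoHomogeneous (stepColor χ) (2 ^ N) (2 * n + m + 4) := by
  intro a ha haN hh
  set e : ℕ → ℕ := fun x => topDiff (a x) (a (x + 1)) with he
  have hne : ∀ j, j ≤ 2 * n → e j ≠ e (j + 1) := fun j hj =>
    topDiff_ne (ha _ _ (by omega) (by omega)) (ha _ _ (by omega) (by omega))
  have hwin : ∀ j, j < 2 * n + 1 → ∃ i : Fin (m + 4) → ℕ, StrictMono i ∧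
      (∀ x, i x < 2 * n + m + 4) ∧ diffs (a ∘ i) = fun x : Fin (m + 3) => e (j + (x : ℕ)) := by
    intro j hj
    refine ⟨fun x => j + (x : ℕ), fun x y hxy => ?_, fun x => ?_, ?_⟩
    · have : (x : ℕ) < y := hxy
      simp only
      omega
    · simp only
      omega
    · funext x
      simp [diffs, he, add_assoc]
  have h2 : 2 % (m + 3) = 2 := Nat.mod_eq_of_lt (by omega)
  suffices hrun : ∃ b ≤ n, (∀ x y, x < y → y < n → e (b + x) < e (b + y)) ∨
      (∀ x y, x < y → y < n → e (b + y) < e (b + x)) by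
    obtain ⟨b, hb, hrun⟩ := hrun
    exact not_homogeneous_of_run h ha haN (show b + n < _ by omega) hrun hh
  rcases hh with hh | hh
  · refine exists_run hne fun j hj hmin => ?_
    obtain ⟨i, hi, hiM, hd⟩ := hwin j hj
    have hc := hh i hi hiM
    have h01 : diffs (a ∘ i) 1 < diffs (a ∘ i) 0 := by simpa [hd] using hmin.1
    have h12 : diffs (a ∘ i) 1 < diffs (a ∘ i) 2 := by simpa [hd, h2] using hmin.2
    rcases hc with ⟨hm, _⟩ | ⟨hm, _⟩ | ⟨hm, _⟩
    · have : diffs (a ∘ i) 0 < diffs (a ∘ i) 1 := hm (by simp)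
      omega
    · have : diffs (a ∘ i) 2 < diffs (a ∘ i) 1 := hm (by simp [Fin.lt_def, h2])
      omega
    · omega
  · obtain ⟨b, hb, hrun⟩ := exists_run (e := fun j => OrderDual.toDual (e j)) (n := n) hne
      fun j hj hmax => by
        obtain ⟨i, hi, hiM, hd⟩ := hwin j hj
        refine hh i hi hiM (Or.inr (Or.inr ⟨?_, ?_⟩))
        · simpa [hd] using hmax.1
        · simpa [hd, h2] using hmax.2
    exact ⟨b, hb, hrun.symm⟩

/-! ### The colouring of triples by convexity -/

/-- The number whose digits in base `3` are the binary digits of `a`. -/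
def spread (a : ℕ) : ℕ := Nat.ofDigits 3 (Nat.digits 2 a)

theorem spread_eq (a : ℕ) : spread a = a % 2 + 3 * spread (a / 2) := by
  rcases Nat.eq_zero_or_pos a with rfl | h
  · simp [spread]
  · rw [spread, Nat.digits_def' (by norm_num) h, Nat.ofDigits_cons]
    simp [spread]

/-- In base `3` the digits below the top differing position `t` change the difference `3 ^ t` by at
most `(3 ^ t - 1) / 2`. The resulting ranges for different `t` are disjoint, so comparing increments
of `spread` compares top positions, without ties. -/
theorem spread_sub_bounds (t : ℕ) : ∀ {a b : ℕ}, a < b → topDiff a b = t →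
    2 * spread a + 3 ^ t + 1 ≤ 2 * spread b ∧ 2 * spread b + 1 ≤ 2 * spread a + 3 ^ (t + 1) := by
  induction t with
  | zero =>
    intro a b hab ht
    have h1 := topDiff_le_iff.mp ht.le
    simp at h1
    have ha := spread_eq a
    have hb := spread_eq b
    rw [← h1] at hb
    simp
    omega
  | succ t ih =>
    intro a b hab ht
    have h1 : a / 2 < b / 2 := by
      by_contra h
      have : topDiff a b ≤ 0 := topDiff_le_iff.mpr (by simp; omega)
      omega
    have h2 : ∀ s, topDiff (a / 2) (b / 2) ≤ s ↔ topDiff a b ≤ s + 1 := fun s => by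
      rw [topDiff_le_iff, topDiff_le_iff, Nat.div_div_eq_div_mul, Nat.div_div_eq_div_mul,
        pow_succ' 2 (s + 1)]
    have h3 : topDiff (a / 2) (b / 2) = t := by
      refine le_antisymm ((h2 t).mpr ht.le) ?_
      by_contra h
      rcases t with _ | t
      · omega
      · have := (h2 t).mp (by omega)
        omega
    have h4 := ih h1 h3
    have ha := spread_eq a
    have hb := spread_eq b
    rw [pow_succ] at h4 ⊢
    rw [pow_succ, pow_succ]
    omega

theorem spread_strictMono : StrictMono spread := fun a b h => by
  have := (spread_sub_bounds _ h rfl).1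
  have : 0 < 3 ^ topDiff a b := by positivity
  omega

theorem two_mul_spread_lt {a b c : ℕ} (hab : a < b) (hbc : b < c)
    (h : topDiff a b < topDiff b c) : 2 * spread b < spread a + spread c := by
  have h1 := (spread_sub_bounds _ hab rfl).2
  have h2 := (spread_sub_bounds _ hbc rfl).1
  have h3 : 3 ^ (topDiff a b + 1) ≤ 3 ^ topDiff b c := Nat.pow_le_pow_right (by norm_num) h
  omega

theorem lt_two_mul_spread {a b c : ℕ} (hab : a < b) (hbc : b < c)
    (h : topDiff b c < topDiff a b) : spread a + spread c < 2 * spread b := by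
  have h1 := (spread_sub_bounds _ hab rfl).1
  have h2 := (spread_sub_bounds _ hbc rfl).2
  have h3 : 3 ^ (topDiff b c + 1) ≤ 3 ^ topDiff a b := Nat.pow_le_pow_right (by norm_num) h
  omega

/-- The colouring of triples by the convexity of `spread`. -/
def convexColor (i : Fin 3 → ℕ) : Prop := 2 * spread (i 1) < spread (i 0) + spread (i 2)

/-- A homogeneous sequence of `N + 2` numbers would have `N + 1` strictly monotone consecutive
differing positions, all below `N`. -/
theorem noHomogeneous_convexColor (N : ℕ) : NoHomogeneous convexColor (2 ^ N) (N + 2) := by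
  intro a ha haN hh
  have hN : ∀ x < N + 1, topDiff (a x) (a (x + 1)) < N := fun x hx =>
    topDiff_lt (ha _ _ (by omega) (by omega)) (haN _ (by omega))
  have hwin : ∀ j, StrictMono ![j, j + 1, j + 2] := fun j => by
    rw [Fin.strictMono_iff_lt_succ]
    intro x
    fin_cases x <;> simp
  have hlt : ∀ j < N, ∀ x, ![j, j + 1, j + 2] x < N + 2 := fun j hj x => by
    fin_cases x <;> simp <;> omega
  rcases hh with hh | hh
  · have hinc : ∀ x < N + 1, x ≤ topDiff (a x) (a (x + 1)) := by
      intro x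
      induction x with
      | zero => simp
      | succ x ih =>
        intro hx
        have h1 := hh _ (hwin x) (hlt x (by omega))
        have h2 := ih (by omega)
        have h3 : a (x + 1 + 1) = a (x + 2) := rfl
        by_contra h4
        rw [h3] at h4
        have := lt_two_mul_spread (ha x (x + 1) (by omega) (by omega))
          (ha (x + 1) (x + 2) (by omega) (by omega)) (lt_of_le_of_ne (by omega)
            (topDiff_ne (ha _ _ (by omega) (by omega)) (ha _ _ (by omega) (by omega))).symm)
        simp [convexColor] at h1
        omega
    have h1 := hinc N (by omega)
    have h2 := hN N (by omega)
    omega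
  · have hdec : ∀ x < N + 1, topDiff (a x) (a (x + 1)) + x < N := by
      intro x
      induction x with
      | zero => exact hN 0
      | succ x ih =>
        intro hx
        have h1 := hh _ (hwin x) (hlt x (by omega))
        have h2 := ih (by omega)
        have h3 : a (x + 1 + 1) = a (x + 2) := rfl
        by_contra h4
        rw [h3] at h4
        have := two_mul_spread_lt (ha x (x + 1) (by omega) (by omega))
          (ha (x + 1) (x + 2) (by omega) (by omega)) (lt_of_le_of_ne (by omega)
            (topDiff_ne (ha _ _ (by omega) (by omega)) (ha _ _ (by omega) (by omega))))
        simp [convexColor] at h1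
        omega
    have := hdec N (by omega)
    omega

/-! ### Asymptotics of the digit sums -/

open Filter Topology

theorem tendsto_sum_pow_div {h : ℕ → ℕ} (hh : StrictMono h) {N t : ℕ} (ht : t < N) {c : ℕ → ℝ}
    (hc : ∀ s, t < s → c s = 0) :
    Tendsto (fun L : ℝ => (∑ s ∈ Finset.range N, c s * L ^ h s) / L ^ h t) atTop (𝓝 (c t)) := by
  have h0 : c t = ∑ s ∈ Finset.range N, if s = t then c t else 0 := by
    simp [ht]
  rw [h0]
  simp only [Finset.sum_div]
  refine tendsto_finsetSum _ fun s _ => ?_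
  rcases lt_trichotomy s t with hst | rfl | hst
  · rw [if_neg hst.ne]
    have hlt := hh hst
    have h1 : Tendsto (fun L : ℝ => c s * (L ^ (h t - h s))⁻¹) atTop (𝓝 (c s * 0)) :=
      ((tendsto_pow_atTop (by omega)).inv_tendsto_atTop).const_mul _
    rw [mul_zero] at h1
    refine h1.congr' ?_
    filter_upwards [eventually_gt_atTop 0] with L hL
    rw [pow_sub₀ _ hL.ne' hlt.le]
    field_simp
  · rw [if_pos rfl]
    refine tendsto_const_nhds.congr' ?_
    filter_upwards [eventually_gt_atTop 0] with L hL
    field_simp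
  · simp [hst.ne', hc s hst]

/-- The point with index `i`: the vectors `v t`, scaled by `L ^ h t`, are summed over the binary
digits of `i`. -/
noncomputable def digitSum {d : ℕ} (h : ℕ → ℕ) (v : ℕ → Fin d → ℝ) (N : ℕ) (L : ℝ) (i : ℕ)
    (a : Fin d) : ℝ :=
  ∑ s ∈ Finset.range N, (bit s i : ℝ) * v s a * L ^ h s

section Limits

variable {d : ℕ} {h : ℕ → ℕ} {v : ℕ → Fin d → ℝ} {N : ℕ}

theorem tendsto_digitSum_sub (hh : StrictMono h) {i j : ℕ} (hij : i < j) (hj : j < 2 ^ N)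
    (a : Fin d) :
    Tendsto (fun L => (digitSum h v N L j a - digitSum h v N L i a) / L ^ h (topDiff i j)) atTop
      (𝓝 (v (topDiff i j) a)) := by
  have h1 := tendsto_sum_pow_div hh (topDiff_lt hij hj)
    (c := fun s => ((bit s j : ℝ) - bit s i) * v s a)
    (fun s hs => by rw [bit_eq_of_topDiff_lt hs, sub_self, zero_mul])
  obtain ⟨h2, h3⟩ := bit_topDiff hij
  simp only [h2, h3, Nat.cast_one, Nat.cast_zero, sub_zero, one_mul] at h1
  refine h1.congr fun L => ?_
  simp only [digitSum, ← Finset.sum_sub_distrib]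
  congr 1
  exact Finset.sum_congr rfl fun s _ => by ring

end Limits

/-- The first coordinates of the differences of consecutive points. -/
def gap {k d : ℕ} (j : Fin k) (x : Fin (k + 1) → Fin (d + 1) → ℝ) : ℝ :=
  x j.succ 0 - x j.castSucc 0

/-- The slopes of the lines through consecutive points. -/
noncomputable def slopes {k d : ℕ} (x : Fin (k + 1) → Fin (d + 1) → ℝ) (j : Fin k) (a : Fin d) :
    ℝ :=
  (x j.succ a.succ - x j.castSucc a.succ) / gap j x

theorem isPolyFun_gap {k d : ℕ} (j : Fin k) : IsPolyFun (gap (d := d) j) :=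
  (IsPolyFun.coord _ _).sub (.coord _ _)

theorem continuous_gap {k d : ℕ} (j : Fin k) : Continuous (gap (d := d) j) := by
  unfold gap
  fun_prop

theorem continuousAt_slopes {k d : ℕ} {x : Fin (k + 1) → Fin (d + 1) → ℝ}
    (hx : ∀ j, gap j x ≠ 0) : ContinuousAt slopes x := by
  refine continuousAt_pi.mpr fun j => continuousAt_pi.mpr fun a => ?_
  refine ContinuousAt.div ?_ (continuous_gap j).continuousAt (hx j)
  fun_prop

section Tuples

variable {k d : ℕ} {h : ℕ → ℕ} {v : ℕ → Fin (d + 1) → ℝ} {N : ℕ} {i : Fin (k + 1) → ℕ}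

theorem tendsto_gap (hh : StrictMono h) (hv : ∀ t, v t 0 = 1) (hi : StrictMono i)
    (hiN : ∀ x, i x < 2 ^ N) (j : Fin k) :
    Tendsto (fun L => gap j (digitSum h v N L ∘ i) / L ^ h (diffs i j)) atTop (𝓝 1) := by
  have := tendsto_digitSum_sub (v := v) hh (hi (Fin.castSucc_lt_succ (i := j))) (hiN j.succ) 0
  rwa [hv] at this

theorem eventually_gap_pos (hh : StrictMono h) (hv : ∀ t, v t 0 = 1) (hi : StrictMono i)
    (hiN : ∀ x, i x < 2 ^ N) (j : Fin k) :
    ∀ᶠ L in atTop, 0 < gap j (digitSum h v N L ∘ i) := by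
  filter_upwards [(tendsto_gap hh hv hi hiN j).eventually_const_lt one_pos, eventually_gt_atTop 0]
    with L hL hL0
  exact (div_pos_iff_of_pos_right (by positivity)).mp hL

/-- The leading term of a difference of points is `v t * L ^ h t` with `t` the top differing
position; normalizing `v t 0 = 1` makes the quotient by the gap tend to the remaining coordinates of
`v t`. -/
theorem tendsto_slopes (hh : StrictMono h) (hv : ∀ t, v t 0 = 1) (hi : StrictMono i)
    (hiN : ∀ x, i x < 2 ^ N) :
    Tendsto (fun L => slopes (digitSum h v N L ∘ i)) atTop
      (𝓝 fun j a => v (diffs i j) a.succ) := by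
  refine tendsto_pi_nhds.mpr fun j => tendsto_pi_nhds.mpr fun a => ?_
  have h1 := tendsto_digitSum_sub (v := v) hh (hi (Fin.castSucc_lt_succ (i := j))) (hiN j.succ)
    a.succ
  have h2 := h1.div (tendsto_gap hh hv hi hiN j) one_ne_zero
  rw [div_one] at h2
  refine h2.congr' ?_
  filter_upwards [eventually_gt_atTop 0] with L hL
  exact div_div_div_cancel_right₀ (by positivity) _ _

/-- If `f` and `g` grow like powers of `L`, then `f < g` once the exponent of `g` is larger. -/
theorem eventually_lt_of_tendsto_div_pow {f g : ℝ → ℝ} {r s : ℕ} (hrs : r < s)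
    (hf : Tendsto (fun L => f L / L ^ r) atTop (𝓝 1))
    (hg : Tendsto (fun L => g L / L ^ s) atTop (𝓝 1)) : ∀ᶠ L in atTop, f L < g L := by
  filter_upwards [hf.eventually_lt_const (show (1 : ℝ) < 2 by norm_num),
    hg.eventually_const_lt (show (1 / 2 : ℝ) < 1 by norm_num), eventually_gt_atTop 4] with L h1 h2 h3
  have hr : 0 < L ^ r := by positivity
  rw [div_lt_iff₀ hr] at h1
  rw [lt_div_iff₀ (by positivity)] at h2
  have h4 : L ^ (r + 1) ≤ L ^ s := pow_le_pow_right₀ (by linarith) hrs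
  rw [pow_succ] at h4
  nlinarith

theorem eventually_gap_lt (hh : StrictMono h) (hv : ∀ t, v t 0 = 1) (hi : StrictMono i)
    (hiN : ∀ x, i x < 2 ^ N) {j l : Fin k} (hjl : diffs i j < diffs i l) :
    ∀ᶠ L in atTop, gap j (digitSum h v N L ∘ i) < gap l (digitSum h v N L ∘ i) :=
  eventually_lt_of_tendsto_div_pow (hh hjl) (tendsto_gap hh hv hi hiN j)
    (tendsto_gap hh hv hi hiN l)

end Tuples

/-! ### Geometric stepping up -/

/-- The geometric form of `stepColor`, with predicates `A` and `B` for increasing and decreasing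
gaps. -/
def stepPred {m d : ℕ} (A B : (Fin (m + 4) → Fin (d + 1) → ℝ) → Prop)
    (x : Fin (m + 4) → Fin (d + 1) → ℝ) : Prop :=
  ((∀ j : Fin (m + 2), gap j.castSucc x < gap j.succ x) ∧ A x) ∨
    ((∀ j : Fin (m + 2), gap j.succ x < gap j.castSucc x) ∧ B x) ∨
      (gap 0 x < gap 1 x ∧ gap 2 x < gap 1 x)

theorem isSemialgebraic_stepPred {m d : ℕ} {A B : (Fin (m + 4) → Fin (d + 1) → ℝ) → Prop}
    (hA : IsSemialgebraic A) (hB : IsSemialgebraic B) : IsSemialgebraic (stepPred A B) :=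
  ((IsSemialgebraic.forall_fin fun _ => .lt (isPolyFun_gap _) (isPolyFun_gap _)).and hA).or
    (((IsSemialgebraic.forall_fin fun _ => .lt (isPolyFun_gap _) (isPolyFun_gap _)).and hB).or
      ((IsSemialgebraic.lt (isPolyFun_gap _) (isPolyFun_gap _)).and
        (.lt (isPolyFun_gap _) (isPolyFun_gap _))))

/-- The points `p t`, `t < N`, robustly induce the colouring `χ` by the predicate `Φ`. -/
def Realizes {k d : ℕ} (Φ : (Fin k → Fin d → ℝ) → Prop) (p : ℕ → Fin d → ℝ)
    (χ : (Fin k → ℕ) → Prop) (N : ℕ) : Prop :=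
  ∀ i : Fin k → ℕ, StrictMono i → (∀ x, i x < N) → ∀ᶠ x in 𝓝 (p ∘ i), (Φ x ↔ χ i)

/-- Consecutive differing positions are distinct, so the one-way hypothesis `hx` already determines
each comparison of consecutive gaps. -/
theorem stepPred_iff_stepColor {m d : ℕ} {A B : (Fin (m + 4) → Fin (d + 1) → ℝ) → Prop}
    {χ : (Fin (m + 3) → ℕ) → Prop} {i : Fin (m + 4) → ℕ} (hi : StrictMono i)
    {x : Fin (m + 4) → Fin (d + 1) → ℝ}
    (hx : ∀ j l, diffs i j < diffs i l → gap j x < gap l x)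
    (hA : StrictMono (diffs i) → (A x ↔ χ (diffs i)))
    (hB : StrictAnti (diffs i) → (B x ↔ χ (diffs i ∘ Fin.rev))) :
    stepPred A B x ↔ stepColor χ i := by
  have hne : ∀ j : Fin (m + 2), diffs i j.castSucc ≠ diffs i j.succ := fun j =>
    topDiff_ne (hi (Fin.castSucc_lt_succ (i := j.castSucc)))
      (hi (Fin.castSucc_lt_succ (i := j.succ)))
  have hlt : ∀ j l, diffs i j ≠ diffs i l → (gap j x < gap l x ↔ diffs i j < diffs i l) := by
    intro j l hjl
    refine ⟨fun h => ?_, hx j l⟩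
    by_contra h'
    exact absurd (hx l j (by omega)) h.not_gt
  have h1 : diffs i 0 ≠ diffs i 1 := hne 0
  have h2 : diffs i 1 ≠ diffs i 2 := hne 1
  rw [stepPred, stepColor, Fin.strictMono_iff_lt_succ, Fin.strictAnti_iff_succ_lt]
  refine or_congr ?_ (or_congr ?_ ?_)
  · simp only [hlt _ _ (hne _)]
    exact and_congr_right fun h => hA (Fin.strictMono_iff_lt_succ.mpr h)
  · simp only [hlt _ _ (hne _).symm]
    exact and_congr_right fun h => hB (Fin.strictAnti_iff_succ_lt.mpr h)
  · rw [hlt _ _ h1, hlt _ _ h2.symm]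

theorem exists_realizes_stepPred {m d : ℕ} {A B : (Fin (m + 4) → Fin (d + 1) → ℝ) → Prop}
    {χ : (Fin (m + 3) → ℕ) → Prop} {h : ℕ → ℕ} {v : ℕ → Fin (d + 1) → ℝ} {N : ℕ}
    (hh : StrictMono h) (hv : ∀ t, v t 0 = 1)
    (hA : ∀ i : Fin (m + 4) → ℕ, StrictMono i → (∀ x, i x < 2 ^ N) → StrictMono (diffs i) →
      ∀ᶠ L in atTop, ∀ᶠ x in 𝓝 (digitSum h v N L ∘ i), (A x ↔ χ (diffs i)))
    (hB : ∀ i : Fin (m + 4) → ℕ, StrictMono i → (∀ x, i x < 2 ^ N) → StrictAnti (diffs i) →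
      ∀ᶠ L in atTop, ∀ᶠ x in 𝓝 (digitSum h v N L ∘ i), (B x ↔ χ (diffs i ∘ Fin.rev))) :
    ∃ p, Realizes (stepPred A B) p (stepColor χ) (2 ^ N) := by
  -- Tuples are indexed by a finite type so that a single `L` can serve all of them.
  have key : ∀ i : Fin (m + 4) → Fin (2 ^ N), ∀ᶠ L in atTop, StrictMono i →
      ∀ᶠ x in 𝓝 (digitSum h v N L ∘ fun j => (i j : ℕ)),
        (stepPred A B x ↔ stepColor χ fun j => (i j : ℕ)) := by
    intro i'
    by_cases hi' : StrictMono i'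
    swap
    · exact .of_forall fun _ h' => absurd h' hi'
    set i : Fin (m + 4) → ℕ := fun j => (i' j : ℕ) with hi_def
    have hi : StrictMono i := fun x y hxy => hi' hxy
    have hiN : ∀ x, i x < 2 ^ N := fun x => (i' x).isLt
    have e1 : ∀ᶠ L in atTop, ∀ j l, diffs i j < diffs i l →
        gap j (digitSum h v N L ∘ i) < gap l (digitSum h v N L ∘ i) := by
      refine eventually_all.mpr fun j => eventually_all.mpr fun l => ?_
      by_cases hjl : diffs i j < diffs i l
      · exact (eventually_gap_lt hh hv hi hiN hjl).mono fun L hL _ => hL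
      · exact .of_forall fun _ h' => absurd h' hjl
    have e2 : ∀ᶠ L in atTop, StrictMono (diffs i) →
        ∀ᶠ x in 𝓝 (digitSum h v N L ∘ i), (A x ↔ χ (diffs i)) := by
      by_cases hm : StrictMono (diffs i)
      · exact (hA i hi hiN hm).mono fun L hL _ => hL
      · exact .of_forall fun _ h' => absurd h' hm
    have e3 : ∀ᶠ L in atTop, StrictAnti (diffs i) →
        ∀ᶠ x in 𝓝 (digitSum h v N L ∘ i), (B x ↔ χ (diffs i ∘ Fin.rev)) := by
      by_cases hm : StrictAnti (diffs i)
      · exact (hB i hi hiN hm).mono fun L hL _ => hL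
      · exact .of_forall fun _ h' => absurd h' hm
    filter_upwards [e1, e2, e3] with L h1 h2 h3 _
    have h1' : ∀ᶠ x in 𝓝 (digitSum h v N L ∘ i), ∀ j l, diffs i j < diffs i l →
        gap j x < gap l x := by
      refine eventually_all.mpr fun j => eventually_all.mpr fun l => ?_
      by_cases hjl : diffs i j < diffs i l
      · exact ((continuous_gap j).continuousAt.eventually_lt (continuous_gap l).continuousAt
          (h1 j l hjl)).mono fun x hx _ => hx
      · exact .of_forall fun _ h' => absurd h' hjl
    have h2' : ∀ᶠ x in 𝓝 (digitSum h v N L ∘ i), StrictMono (diffs i) → (A x ↔ χ (diffs i)) := by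
      by_cases hm : StrictMono (diffs i)
      · exact (h2 hm).mono fun x hx _ => hx
      · exact .of_forall fun _ h' => absurd h' hm
    have h3' : ∀ᶠ x in 𝓝 (digitSum h v N L ∘ i), StrictAnti (diffs i) →
        (B x ↔ χ (diffs i ∘ Fin.rev)) := by
      by_cases hm : StrictAnti (diffs i)
      · exact (h3 hm).mono fun x hx _ => hx
      · exact .of_forall fun _ h' => absurd h' hm
    filter_upwards [h1', h2', h3'] with x hx1 hx2 hx3
    exact stepPred_iff_stepColor hi hx1 hx2 hx3
  obtain ⟨L, hL⟩ := (eventually_all.mpr key).exists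
  exact ⟨digitSum h v N L, fun i hi hiN => hL (fun j => ⟨i j, hiN j⟩) fun x y hxy => hi hxy⟩

/-- The predicate `Φ` applied to the slopes between consecutive points. -/
def slopePred {k d : ℕ} (Φ : (Fin k → Fin d → ℝ) → Prop) (r : Fin k → Fin k)
    (x : Fin (k + 1) → Fin (d + 1) → ℝ) : Prop :=
  (∀ j, 0 < gap (r j) x) ∧ Φ (slopes x ∘ r)

theorem IsSemialgebraic.slopePred {k d : ℕ} {Φ : (Fin k → Fin d → ℝ) → Prop}
    (hΦ : IsSemialgebraic Φ) (r : Fin k → Fin k) : IsSemialgebraic (slopePred Φ r) :=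
  hΦ.comp_div (num := fun i j x => x (r i).succ j.succ - x (r i).castSucc j.succ)
    (den := fun i => gap (r i)) (fun _ _ => (IsPolyFun.coord _ _).sub (.coord _ _))
    (fun _ => isPolyFun_gap _)

/-- The slopes eventually enter the neighbourhood of `p ∘ diffs i ∘ r` on which `Φ` has the right
value. Slopes are continuous where the gaps are nonzero, so this persists under perturbation. The
reindexing `r` puts decreasing differences into increasing order. -/
theorem eventually_slopePred {k d : ℕ} {Φ : (Fin k → Fin d → ℝ) → Prop} {p : ℕ → Fin d → ℝ}
    {χ : (Fin k → ℕ) → Prop} {N : ℕ} (hΦ : Realizes Φ p χ N) {h : ℕ → ℕ} (hh : StrictMono h)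
    {v : ℕ → Fin (d + 1) → ℝ} (hv : ∀ t, v t = Fin.cons 1 (p t)) {i : Fin (k + 1) → ℕ}
    (hi : StrictMono i) (hiN : ∀ x, i x < 2 ^ N) (r : Fin k → Fin k)
    (hr : StrictMono (diffs i ∘ r)) :
    ∀ᶠ L in atTop, ∀ᶠ x in 𝓝 (digitSum h v N L ∘ i), (slopePred Φ r x ↔ χ (diffs i ∘ r)) := by
  have hv0 : ∀ t, v t 0 = 1 := fun t => by rw [hv, Fin.cons_zero]
  have hlt : ∀ x, (diffs i ∘ r) x < N := fun x => topDiff_lt (hi Fin.castSucc_lt_succ) (hiN _)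
  have hcomp : Continuous fun y : Fin k → Fin d → ℝ => y ∘ r := by
    refine continuous_pi fun j => ?_
    exact continuous_apply (r j)
  have hlim : Tendsto (fun L => slopes (digitSum h v N L ∘ i) ∘ r) atTop (𝓝 (p ∘ diffs i ∘ r)) := by
    have h1 := (hcomp.tendsto _).comp (tendsto_slopes hh hv0 hi hiN)
    have h2 : (fun j a => v (diffs i j) a.succ) ∘ r = p ∘ diffs i ∘ r := by
      funext j a
      simp [hv]
    rwa [h2] at h1
  have e1 := hlim.eventually (hΦ _ hr hlt).eventually_nhds
  have e2 := eventually_all.mpr fun j => eventually_gap_pos hh hv0 hi hiN j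
  filter_upwards [e1, e2] with L h1 h2
  have hc : ContinuousAt (fun x => slopes x ∘ r) (digitSum h v N L ∘ i) :=
    hcomp.continuousAt.comp (continuousAt_slopes fun j => (h2 j).ne')
  have h2' : ∀ᶠ x in 𝓝 (digitSum h v N L ∘ i), ∀ j, 0 < gap j x :=
    eventually_all.mpr fun j => (continuous_gap j).continuousAt.eventually_const_lt (h2 j)
  filter_upwards [hc.eventually h1, h2'] with x hx1 hx2
  rw [slopePred, hx1]
  exact and_iff_right fun j => hx2 _

theorem exists_realizes_step {m d : ℕ} {Φ : (Fin (m + 3) → Fin d → ℝ) → Prop}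
    {p : ℕ → Fin d → ℝ} {χ : (Fin (m + 3) → ℕ) → Prop} {N : ℕ} (hΦ : Realizes Φ p χ N) :
    ∃ q, Realizes (stepPred (slopePred Φ id) (slopePred Φ Fin.rev)) q (stepColor χ) (2 ^ N) :=
  exists_realizes_stepPred (h := id) (v := fun t => Fin.cons 1 (p t)) strictMono_id
    (fun _ => Fin.cons_zero _ _)
    (fun _ hi hiN hm => eventually_slopePred hΦ strictMono_id (fun _ => rfl) hi hiN id hm)
    (fun _ hi hiN hm => eventually_slopePred hΦ strictMono_id (fun _ => rfl) hi hiN Fin.rev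
      (hm.comp Fin.rev_strictAnti))

/-! ### The base configuration on the line -/

/-- Log-convexity of the gaps. -/
def logConvexPred (x : Fin 4 → Fin 1 → ℝ) : Prop := gap 1 x * gap 1 x < gap 0 x * gap 2 x

theorem isSemialgebraic_logConvexPred : IsSemialgebraic logConvexPred :=
  .lt ((isPolyFun_gap _).mul (isPolyFun_gap _)) ((isPolyFun_gap _).mul (isPolyFun_gap _))

/-- A product of two gaps grows like `L` to the sum of their exponents; `hne` excludes the tie in
which leading terms would not decide. -/
theorem eventually_logConvexPred {N : ℕ} {i : Fin 4 → ℕ} (hi : StrictMono i)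
    (hiN : ∀ x, i x < 2 ^ N)
    (hne : spread (diffs i 0) + spread (diffs i 2) ≠ 2 * spread (diffs i 1)) :
    ∀ᶠ L in atTop, ∀ᶠ x in 𝓝 (digitSum spread (fun _ _ => 1) N L ∘ i),
      (logConvexPred x ↔ convexColor (diffs i)) := by
  have hprod : ∀ j l : Fin 3, Tendsto (fun L =>
      (gap j (digitSum (d := 0 + 1) spread (fun _ _ => 1) N L ∘ i) *
        gap l (digitSum (d := 0 + 1) spread (fun _ _ => 1) N L ∘ i)) /
          L ^ (spread (diffs i j) + spread (diffs i l))) atTop (𝓝 1) := by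
    intro j l
    have h := tendsto_gap (d := 0) (v := fun _ _ => 1) spread_strictMono (fun _ => rfl) hi hiN
    have h1 := (h j).mul (h l)
    rw [mul_one] at h1
    exact h1.congr fun L => by rw [pow_add, div_mul_div_comm]
  have hcont : ∀ j l : Fin 3, Continuous fun x : Fin 4 → Fin 1 → ℝ => gap j x * gap l x :=
    fun j l => (continuous_gap j).mul (continuous_gap l)
  rcases lt_or_gt_of_ne hne with h | h
  · have hχ : ¬ convexColor (diffs i) := by
      unfold convexColor
      omega
    filter_upwards [eventually_lt_of_tendsto_div_pow (by omega) (hprod 0 2) (hprod 1 1)] with L hL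
    filter_upwards [(hcont 0 2).continuousAt.eventually_lt (hcont 1 1).continuousAt hL] with x hx
    exact iff_of_false hx.not_gt hχ
  · have hχ : convexColor (diffs i) := h
    filter_upwards [eventually_lt_of_tendsto_div_pow (by omega) (hprod 1 1) (hprod 0 2)] with L hL
    filter_upwards [(hcont 1 1).continuousAt.eventually_lt (hcont 0 2).continuousAt hL] with x hx
    exact iff_of_true hx hχ

theorem convexColor_comp_rev (t : Fin 3 → ℕ) : convexColor (t ∘ Fin.rev) ↔ convexColor t := by
  simp [convexColor, add_comm, show (2 : Fin 3).rev = 0 from rfl, show (1 : Fin 3).rev = 1 from rfl]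

theorem spread_add_ne {a b c : ℕ} (hab : a < b) (hbc : b < c) :
    spread a + spread c ≠ 2 * spread b := by
  rcases lt_or_gt_of_ne (topDiff_ne hab hbc) with h | h
  · have := two_mul_spread_lt hab hbc h
    omega
  · have := lt_two_mul_spread hab hbc h
    omega

theorem exists_realizes_base (N : ℕ) :
    ∃ q, Realizes (stepPred logConvexPred logConvexPred) q (stepColor (m := 0) convexColor)
      (2 ^ N) := by
  refine exists_realizes_stepPred (h := spread) (v := fun _ _ => 1) spread_strictMono
    (fun _ => rfl) (fun i hi hiN hm => eventually_logConvexPred hi hiN ?_)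
    (fun i hi hiN hm => ?_)
  · exact spread_add_ne (hm (by simp)) (hm (by simp))
  · rw [convexColor_comp_rev]
    refine eventually_logConvexPred hi hiN ?_
    rw [add_comm]
    exact spread_add_ne (hm (by simp)) (hm (by simp))

/-! ### The tower bound -/

theorem twr_monotone : ∀ i : ℕ, Monotone (twr i)
  | 0 => fun _ _ h => h
  | 1 => fun _ _ h => h
  | i + 2 => fun _ _ h => Real.rpow_le_rpow_of_exponent_le one_le_two (twr_monotone (i + 1) h)

/-- Large robust configurations without homogeneous sets, by induction on the dimension. -/
theorem exists_tower_configuration (e : ℕ) :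
    ∃ Φ : (Fin (e + 4) → Fin (e + 1) → ℝ) → Prop, IsSemialgebraic Φ ∧
      ∃ c : ℝ, 0 < c ∧ ∃ n₀ : ℕ, ∀ n : ℕ, n₀ ≤ n → ∃ (N : ℕ) (χ : (Fin (e + 4) → ℕ) → Prop)
        (p : ℕ → Fin (e + 1) → ℝ), twr (e + 3) (c * n) ≤ N ∧ NoHomogeneous χ N n ∧
          Realizes Φ p χ N := by
  induction e with
  | zero =>
    refine ⟨stepPred logConvexPred logConvexPred,
      isSemialgebraic_stepPred isSemialgebraic_logConvexPred isSemialgebraic_logConvexPred,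
      1 / 4, by norm_num, 18, fun n hn => ?_⟩
    -- Stepping up `m + 2` gives `2 * (m + 2) + 4 = 2 * m + 8`, at most `n`; the threshold `18`
    -- ensures `n ≤ 4 * m`.
    set m := (n - 8) / 2 with hm
    obtain ⟨q, hq⟩ := exists_realizes_base (2 ^ m)
    refine ⟨2 ^ 2 ^ m, stepColor (m := 0) convexColor, q, ?_,
      (noHomogeneous_convexColor m).step.mono (by omega), hq⟩
    have h1 : (n : ℝ) ≤ 4 * m := by
      exact_mod_cast (show n ≤ 4 * m by omega)
    have h2 : twr 3 (1 / 4 * n) ≤ twr 3 m := twr_monotone 3 (by linarith)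
    refine h2.trans_eq ?_
    push_cast
    simp only [twr]
    norm_cast
  | succ e ih =>
    obtain ⟨Φ, hΦ, c, hc, n₀, H⟩ := ih
    refine ⟨stepPred (slopePred Φ id) (slopePred Φ Fin.rev),
      isSemialgebraic_stepPred (m := e + 1) (hΦ.slopePred id) (hΦ.slopePred Fin.rev),
      c / 4, by positivity, 2 * n₀ + 2 * e + 12, fun n hn => ?_⟩
    -- Here stepping up gives `2 * m + e + 5`, at most `n`; the threshold ensures both `n₀ ≤ m` and
    -- `n ≤ 4 * m`.
    set m := (n - e - 5) / 2 with hm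
    obtain ⟨N, χ, p, hN, hχ, hp⟩ := H m (by omega)
    obtain ⟨q, hq⟩ := exists_realizes_step (m := e + 1) hp
    refine ⟨2 ^ N, stepColor (m := e + 1) χ, q, ?_, (NoHomogeneous.step (m := e + 1) hχ).mono
      (by omega), hq⟩
    have h1 : (n : ℝ) ≤ 4 * m := by
      exact_mod_cast (show n ≤ 4 * m by omega)
    have h2 : twr (e + 3) (c / 4 * n) ≤ N :=
      (twr_monotone _ (by nlinarith)).trans hN
    push_cast
    rw [← Real.rpow_natCast]
    exact Real.rpow_le_rpow_of_exponent_le one_le_two h2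

theorem not_forcesHomogeneous {k d n N N' : ℕ} {Φ : (Fin k → Fin d → ℝ) → Prop}
    {χ : (Fin k → ℕ) → Prop} {p : ℕ → Fin d → ℝ} (hχ : NoHomogeneous χ N n)
    (hp : Realizes Φ p χ N) (hN : N' ≤ N) : ¬ ForcesHomogeneous Φ n N' := by
  intro hF
  obtain ⟨s, hs, hh⟩ := hF fun x => p x
  set s' : ℕ → ℕ := fun x => if hx : x < n then s ⟨x, hx⟩ else 0 with hs'
  have hval : ∀ x (hx : x < n), s' x = s ⟨x, hx⟩ := fun x hx => by simp [hs', hx]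
  have hs'N : ∀ x < n, s' x < N := fun x hx => by
    rw [hval x hx]
    omega
  have hmono : ∀ x y, x < y → y < n → s' x < s' y := fun x y hxy hy => by
    rw [hval x (hxy.trans hy), hval y hy]
    exact hs hxy
  have hΦ : ∀ (i : Fin k → ℕ), StrictMono i → ∀ hi : ∀ x, i x < n,
      (Φ ((fun x : Fin N' => p x) ∘ s ∘ fun j => ⟨i j, hi j⟩) ↔ χ (s' ∘ i)) := by
    intro i him hi
    have h1 := (hp (s' ∘ i) (fun x y hxy => hmono _ _ (him hxy) (hi y))
      fun x => hs'N _ (hi x)).self_of_nhds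
    have h2 : p ∘ s' ∘ i = (fun x : Fin N' => p x) ∘ s ∘ fun j => ⟨i j, hi j⟩ := by
      funext j
      simp [hval _ (hi j)]
    rwa [h2] at h1
  refine hχ s' hmono hs'N ?_
  rcases hh with hh | hh
  · exact Or.inl fun i him hi => (hΦ i him hi).mp (hh _ fun x y hxy => him hxy)
  · exact Or.inr fun i him hi hc => hh _ (fun x y hxy => him hxy) ((hΦ i him hi).mpr hc)

theorem theorem1p3 (d : ℕ) (hd : 2 ≤ d) :
    ∃ Φ : (Fin (d + 3) → Fin d → ℝ) → Prop, IsSemialgebraic Φ ∧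
      ∃ c : ℝ, 0 < c ∧ ∃ n₀ : ℕ, ∀ n : ℕ, n₀ ≤ n →
        twr (d + 2) (c * (n : ℝ)) ≤ (ramseyFun Φ n : ℝ) := by
  obtain ⟨e, rfl⟩ : ∃ e, d = e + 1 := ⟨d - 1, by omega⟩
  obtain ⟨Φ, hΦ, c, hc, n₀, H⟩ := exists_tower_configuration e
  refine ⟨Φ, hΦ, c, hc, n₀, fun n hn => ?_⟩
  obtain ⟨N, χ, p, hN, hχ, hp⟩ := H n hn
  refine hN.trans (Nat.cast_le.mpr ?_)
  -- Ramsey's theorem ensures that the infimum is attained and is not the default value `0` of an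
  -- empty set.
  by_contra h
  exact not_forcesHomogeneous hχ hp (not_le.mp h).le
    (Nat.sInf_mem (s := {M | ForcesHomogeneous Φ n M}) (exists_forcesHomogeneous Φ n))
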